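/- Let $\alpha,\beta,n>0$ and $0<r_0\le R$ be real constants, let $r:[0,\infty)\to\mathbb R$ be Lebesgue measurable with $r_0\le r(t)\le R$, and let $h:[0,\infty)\to\mathbb R$ be Lebesgue measurable with $h(t)\le t$ and $t-h(t)\le h_0$ for all $t\ge 0$. Let $K$ be the unique positive solution of $\beta K^{n+1}=\alpha(1+K^n)$, and put $$\mu=\frac{\alpha}{\beta},\quad M=\frac{\alpha}{\beta}\left[1+\left(\frac{\beta}{\alpha}\right)^n\right],\quad c=\ln\frac{\mu}{K},\quad C=\ln\frac{M}{K},$$ $$a_0=\frac{\alpha}{K}\,\frac{1-e^{-C}}{C}\,r_0,\qquad A=\frac{\alpha}{K}\,\frac{1-e^{-c}}{c}\,R,\qquad b_0=\frac{\beta nR}{4}.$$ Suppose that $$\frac{a_0}{b_0}\,e^{-Ah_0}>\ln\frac{b_0^2+a_0b_0}{b_0^2+a_0^2}.$$ Let $\varphi:(-\infty,0]\to[0,\infty)$ be bounded and Borel measurable with $\varphi(0)>0$. Then every solution $x$ of $$\dot x(t)=r(t)\left[\alpha-\frac{\beta\,x(t)\,x^n(h(t))}{1+x^n(h(t))}\right],\quad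 t\ge 0,\qquad x(t)=\varphi(t),\quad t\le 0,$$ that is, every function $x:\mathbb R\to\mathbb R$ that is locally absolutely continuous on $[0,\infty)$, satisfies the differential equation for almost all $t\ge 0$ and equals $\varphi$ on $(-\infty,0]$, satisfies $\lim_{t\to\infty}x(t)=K$. -/

import Mathlib

open MeasureTheory Set Filter Topology

namespace MackeyGlass

/-- `x` is a solution of the Mackey-Glass respiratory equation
`x'(t) = r(t) * (α - β * x(t) * x(h(t))^n / (1 + x(h(t))^n))` for almost all `t ≥ 0`,
with `x(t) = φ(t)` for `t ≤ 0`, where `x` is absolutely continuous on `[0, T]` for every `T`. -/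
structure IsSolution (α β n : ℝ) (r h φ x : ℝ → ℝ) : Prop where
  absCont : ∀ T : ℝ, 0 ≤ T → AbsolutelyContinuousOnInterval x 0 T
  deriv_eq : ∀ᵐ t ∂(volume.restrict (Ici (0 : ℝ))),
    HasDerivAt x (r t * (α - β * x t * x (h t) ^ n / (1 + x (h t) ^ n))) t
  initial : ∀ t : ℝ, t ≤ 0 → x t = φ t

/-- `K` is the positive equilibrium: the (unique) positive root of `β K^(n+1) = α (1 + K^n)`. -/
def IsPositiveEquilibrium (α β n K : ℝ) : Prop :=
  0 < K ∧ β * K ^ (n + 1) = α * (1 + K ^ n)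

/-- The asymptotic lower bound `μ = α / β`. -/
noncomputable def lowerBound (α β : ℝ) : ℝ := α / β

/-- The asymptotic upper bound `M = (α / β) (1 + (β / α)^n)`. -/
noncomputable def upperBound (α β n : ℝ) : ℝ := α / β * (1 + (β / α) ^ n)

/-- `c = ln (μ / K)`. -/
noncomputable def logLower (α β K : ℝ) : ℝ := Real.log (lowerBound α β / K)

/-- `C = ln (M / K)`. -/
noncomputable def logUpper (α β n K : ℝ) : ℝ := Real.log (upperBound α β n / K)

/-- `a₀ = (α / K) ((1 - e^(-C)) / C) r₀`. -/
noncomputable def coeffLower (α β n K r₀ : ℝ) : ℝ :=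
  α / K * ((1 - Real.exp (-logUpper α β n K)) / logUpper α β n K) * r₀

/-- `A = (α / K) ((1 - e^(-c)) / c) R`. -/
noncomputable def coeffUpper (α β K R : ℝ) : ℝ :=
  α / K * ((1 - Real.exp (-logLower α β K)) / logLower α β K) * R

/-- `b₀ = β n R / 4`. -/
noncomputable def delayCoeff (β n R : ℝ) : ℝ := β * n * R / 4

/-- `(a₀ / b₀) e^(-A h₀) > ln ((b₀² + a₀ b₀) / (b₀² + a₀²))`. -/
def StabilityInequality (a₀ A b₀ h₀ : ℝ) : Prop :=
  a₀ / b₀ * Real.exp (-(A * h₀)) > Real.log ((b₀ ^ 2 + a₀ * b₀) / (b₀ ^ 2 + a₀ ^ 2))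

end MackeyGlass

namespace MackeyGlass

/-! For `y = ln (x / K)` the equation reads `y' = -a y - b y(h)` with solution-dependent
coefficients. Once `y` lies in `[c, C]`, convexity of `exp` gives `a₀ ≤ a ≤ A`, and the slope of the
logistic function gives `0 ≤ b ≤ b₀`. In the new time `P = ∫ a` the delay is at most `H = A h₀`, and
`b ≤ q a` with `q = b₀ / a₀`.

Let `|y| ≤ L` and let `y` become positive after a zero `t₀`. Write `p = P - P t₀`. The growth rate
of `e^p y` in `p` is at most `q L e^p`, because `y(h) ≥ -L`. It is also at most `q² L (e^H - e^p)`: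
before the zero `y` cannot be very negative (`neg_le_backward`), and after it the delayed term only
pushes down. Splicing the two bounds where they cross and maximising gives `y ≤ L (1 - e^(-H) q (1 -
q e^H ln ((q² + q) / (q² + 1))))` (`le_forward`). The stability inequality says exactly that the
inner bracket is positive, so each pass shrinks the bound on `|y|` by a fixed factor; a solution
without late zeros decays anyway. Iteration gives `y → 0`.

It remains to see that `x` stays positive and enters `[μ, M]` in finite time, so that `y` does enter
`[c, C]`. -/

/-! ### Absolutely continuous functions and differential inequalities -/

theorem le_of_ae_hasDerivAt_nonpos {F : ℝ → ℝ} {a b : ℝ} (hab : a ≤ b)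
    (hF : AbsolutelyContinuousOnInterval F a b)
    (hd : ∀ᵐ t, t ∈ Ioo a b → ∃ d, HasDerivAt F d t ∧ d ≤ 0) : F b ≤ F a := by
  have h1 := hF.integral_deriv_eq_sub
  have h2 : ∫ t in a..b, deriv F t ≤ 0 := by
    rw [intervalIntegral.integral_of_le hab, integral_Ioc_eq_integral_Ioo]
    apply integral_nonpos_of_ae
    rw [EventuallyLE, ae_restrict_iff' measurableSet_Ioo]
    filter_upwards [hd] with t ht htm
    obtain ⟨d, h, hd⟩ := ht htm
    simpa [h.deriv] using hd
  linarith

/-- A `C¹` function is Lipschitz on a compact interval, and Lipschitz maps preserve absolute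
continuity. -/
theorem absolutelyContinuousOnInterval_comp_contDiffOn {F g : ℝ → ℝ} {a b m M : ℝ}
    (hF : AbsolutelyContinuousOnInterval F a b) (hg : ContDiffOn ℝ 1 g (Icc m M))
    (hm : MapsTo F (uIcc a b) (Icc m M)) :
    AbsolutelyContinuousOnInterval (fun t => g (F t)) a b := by
  obtain ⟨K, hK⟩ := hg.exists_lipschitzOnWith (by decide) (convex_Icc _ _) isCompact_Icc
  unfold AbsolutelyContinuousOnInterval at hF ⊢
  have h0 := hF.const_mul (K : ℝ)
  rw [mul_zero] at h0
  refine squeeze_zero' (Eventually.of_forall fun E => Finset.sum_nonneg fun i _ => dist_nonneg)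
    ?_ h0
  refine Eventually.filter_mono inf_le_right ?_
  rw [eventually_principal]
  intro E hE
  rw [Finset.mul_sum]
  refine Finset.sum_le_sum fun i hi => ?_
  exact hK.dist_le_mul _ (hm (hE.1 i hi).1) _ (hm (hE.1 i hi).2)

theorem absolutelyContinuousOnInterval_exp {F : ℝ → ℝ} {a b : ℝ}
    (hF : AbsolutelyContinuousOnInterval F a b) :
    AbsolutelyContinuousOnInterval (fun t => Real.exp (F t)) a b := by
  obtain ⟨C, hC⟩ := hF.exists_bound
  exact absolutelyContinuousOnInterval_comp_contDiffOn (m := -C) (M := C) hF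
    Real.contDiff_exp.contDiffOn fun t ht => abs_le.1 (hC t ht)

theorem absolutelyContinuousOnInterval_log {F : ℝ → ℝ} {a b : ℝ}
    (hF : AbsolutelyContinuousOnInterval F a b) (hpos : ∀ t ∈ uIcc a b, 0 < F t) :
    AbsolutelyContinuousOnInterval (fun t => Real.log (F t)) a b := by
  obtain ⟨C, hC⟩ := hF.exists_bound
  obtain ⟨t₀, ht₀, hmin⟩ := isCompact_uIcc.exists_isMinOn nonempty_uIcc hF.continuousOn
  refine absolutelyContinuousOnInterval_comp_contDiffOn (m := F t₀) (M := C) hF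
    (fun u hu => (Real.contDiffAt_log.2 ?_).contDiffWithinAt) fun t ht =>
    ⟨hmin ht, (abs_le.1 (hC t ht)).2⟩
  exact ((hpos t₀ ht₀).trans_le hu.1).ne'

theorem exists_last_mem {s : Set ℝ} {a b : ℝ} (hs : IsClosed (s ∩ Icc a b)) (ha : a ∈ s)
    (hab : a ≤ b) : ∃ c ∈ s, a ≤ c ∧ c ≤ b ∧ ∀ t, c < t → t ≤ b → t ∉ s := by
  have hne : (s ∩ Icc a b).Nonempty := ⟨a, ha, le_rfl, hab⟩
  have hbdd : BddAbove (s ∩ Icc a b) := ⟨b, fun t ht => ht.2.2⟩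
  obtain ⟨h1, h2, h3⟩ := hs.csSup_mem hne hbdd
  refine ⟨_, h1, h2, h3, fun t hct htb hts => ?_⟩
  exact absurd (le_csSup hbdd ⟨hts, h2.trans hct.le, htb⟩) (not_le.2 hct)

/-- Below `m` the function grows at rate at least `δ`, so it reaches `m` in finite time; after a
last visit to `[m, ∞)` it could only rise, so it never leaves. -/
theorem eventually_ge_of_ae_deriv {x : ℝ → ℝ} {T m δ : ℝ} (hδ : 0 < δ)
    (hx : ∀ s t, T ≤ s → s ≤ t → AbsolutelyContinuousOnInterval x s t)
    (hd : ∀ᵐ t, T ≤ t → x t < m → ∃ d, HasDerivAt x d t ∧ δ ≤ d) :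
    ∃ T' ≥ T, ∀ t ≥ T', m ≤ x t := by
  have key : ∀ s t, T ≤ s → s ≤ t → (∀ u ∈ Ioo s t, x u < m) → x s + δ * (t - s) ≤ x t := by
    intro s t hs hst hu
    have h1 : AbsolutelyContinuousOnInterval (fun u => δ * u - x u) s t :=
      (AbsolutelyContinuousOnInterval.const_mul δ (f := fun u => u)
        contDiff_id.contDiffOn.absolutelyContinuousOnInterval).fun_sub (hx s t hs hst)
    have := le_of_ae_hasDerivAt_nonpos hst h1 (by
      filter_upwards [hd] with u hu1 hu2
      obtain ⟨d, h, h'⟩ := hu1 (hs.trans hu2.1.le) (hu u hu2)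
      exact ⟨_, ((hasDerivAt_id u).const_mul δ).sub h, by simpa using h'⟩)
    linarith
  have hex : ∃ s ≥ T, m ≤ x s := by
    by_contra! hc
    set t := T + (max (m - x T) 0) / δ
    have ht : T ≤ t := by simp only [t]; have := div_nonneg (le_max_right (m - x T) 0) hδ.le; linarith
    have h1 := key T t le_rfl ht fun u hu => hc u hu.1.le
    have h2 := hc t ht
    have h3 : δ * (t - T) = max (m - x T) 0 := by simp only [t]; field_simp; ring
    have := le_max_left (m - x T) 0
    linarith
  obtain ⟨s, hs, hms⟩ := hex
  refine ⟨s, hs, fun t ht => ?_⟩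
  by_contra! hlt
  have hcont : ContinuousOn x (Icc s t) := by
    simpa [uIcc_of_le ht] using (hx s t hs ht).continuousOn
  have hcl : IsClosed ({u | m ≤ x u} ∩ Icc s t) := by
    rw [inter_comm]
    exact hcont.preimage_isClosed_of_isClosed isClosed_Icc isClosed_Ici
  obtain ⟨c, hc, hsc, hct, hlast⟩ := exists_last_mem hcl hms ht
  have h1 := key c t (hs.trans hsc) hct fun u hu => not_le.1 (hlast u hu.1 hu.2.le)
  have h2 : 0 ≤ δ * (t - c) := mul_nonneg hδ.le (by linarith)
  have h3 : m ≤ x c := hc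
  linarith

theorem eventually_le_of_ae_deriv {x : ℝ → ℝ} {T m δ : ℝ} (hδ : 0 < δ)
    (hx : ∀ s t, T ≤ s → s ≤ t → AbsolutelyContinuousOnInterval x s t)
    (hd : ∀ᵐ t, T ≤ t → m < x t → ∃ d, HasDerivAt x d t ∧ d ≤ -δ) :
    ∃ T' ≥ T, ∀ t ≥ T', x t ≤ m := by
  obtain ⟨T', h1, h2⟩ := eventually_ge_of_ae_deriv (x := fun t => -x t) (m := -m) hδ
    (fun s t hs hst => (hx s t hs hst).fun_neg) (by
      filter_upwards [hd] with t ht hT hlt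
      obtain ⟨d, h, h'⟩ := ht hT (by linarith)
      exact ⟨-d, h.neg, by linarith⟩)
  exact ⟨T', h1, fun t ht => by linarith [h2 t ht]⟩

/-! ### The linear delay equation -/

/-- `y' = -a y - b y(h)` almost everywhere on `[T, ∞)`, where `P` is a primitive of `a`,
`0 ≤ b ≤ q a`, and the delay is at most `h₀` in the time `t` and at most `H` in the time `P`. -/
structure IsDelaySolution (T h₀ a₀ q H : ℝ) (a b h P y : ℝ → ℝ) : Prop where
  absCont : ∀ s t, T ≤ s → s ≤ t → AbsolutelyContinuousOnInterval y s t
  absCont_primitive : ∀ s t, T ≤ s → s ≤ t → AbsolutelyContinuousOnInterval P s t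
  deriv_primitive : ∀ᵐ t, T ≤ t → HasDerivAt P (a t) t
  deriv_eq : ∀ᵐ t, T ≤ t → HasDerivAt y (-(a t * y t) - b t * y (h t)) t
  le_rate : ∀ t, T ≤ t → a₀ ≤ a t
  coeff_mem : ∀ t, T ≤ t → 0 ≤ b t ∧ b t ≤ q * a t
  delay_mem : ∀ t, T ≤ t → t - h₀ ≤ h t ∧ h t ≤ t
  primitive_delay : ∀ t, T + h₀ ≤ t → P t - P (h t) ≤ H

namespace IsDelaySolution

variable {T h₀ a₀ q H : ℝ} {a b h P y : ℝ → ℝ}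

theorem neg (S : IsDelaySolution T h₀ a₀ q H a b h P y) :
    IsDelaySolution T h₀ a₀ q H a b h P (fun t => -y t) where
  __ := S
  absCont s t hs hst := (S.absCont s t hs hst).fun_neg
  deriv_eq := by
    filter_upwards [S.deriv_eq] with t ht hT
    exact (ht hT).neg.congr_deriv (by ring)

theorem delay_nonneg (S : IsDelaySolution T h₀ a₀ q H a b h P y) : 0 ≤ h₀ := by
  have := S.delay_mem T le_rfl
  linarith

theorem mul_le_primitive_sub (S : IsDelaySolution T h₀ a₀ q H a b h P y) {s t : ℝ}
    (hs : T ≤ s) (hst : s ≤ t) : a₀ * (t - s) ≤ P t - P s := by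
  have := le_of_ae_hasDerivAt_nonpos hst ((AbsolutelyContinuousOnInterval.const_mul a₀
    (f := fun u => u) contDiff_id.contDiffOn.absolutelyContinuousOnInterval).fun_sub
    (S.absCont_primitive s t hs hst)) (by
    filter_upwards [S.deriv_primitive] with u hu hm
    have hT := hs.trans hm.1.le
    exact ⟨_, ((hasDerivAt_id' u).const_mul a₀).sub (hu hT), by linarith [S.le_rate u hT]⟩)
  linarith

theorem primitive_le (S : IsDelaySolution T h₀ a₀ q H a b h P y) (ha₀ : 0 < a₀) {s t : ℝ}
    (hs : T ≤ s) (hst : s ≤ t) : P s ≤ P t := by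
  have := S.mul_le_primitive_sub hs hst
  have := mul_nonneg ha₀.le (sub_nonneg.2 hst)
  linarith

theorem mono (S : IsDelaySolution T h₀ a₀ q H a b h P y) {T' : ℝ} (hT : T ≤ T') :
    IsDelaySolution T' h₀ a₀ q H a b h P y where
  absCont s t hs := S.absCont s t (hT.trans hs)
  absCont_primitive s t hs := S.absCont_primitive s t (hT.trans hs)
  deriv_primitive := S.deriv_primitive.mono fun _ ht h => ht (hT.trans h)
  deriv_eq := S.deriv_eq.mono fun _ ht h => ht (hT.trans h)
  le_rate t ht := S.le_rate t (hT.trans ht)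
  coeff_mem t ht := S.coeff_mem t (hT.trans ht)
  delay_mem t ht := S.delay_mem t (hT.trans ht)
  primitive_delay t ht := S.primitive_delay t (by linarith)

theorem absCont_exp_mul (S : IsDelaySolution T h₀ a₀ q H a b h P y) (c : ℝ) {s t : ℝ}
    (hs : T ≤ s) (hst : s ≤ t) :
    AbsolutelyContinuousOnInterval (fun u => Real.exp (P u - c) * y u) s t :=
  (absolutelyContinuousOnInterval_exp ((S.absCont_primitive s t hs hst).fun_sub
    (contDiff_const (c := c)).contDiffOn.absolutelyContinuousOnInterval)).fun_mul
    (S.absCont s t hs hst)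

/-- Comparison of `e^P y` with a function of `P` along a solution. -/
theorem exp_mul_sub_le (S : IsDelaySolution T h₀ a₀ q H a b h P y) (c : ℝ) {s t : ℝ}
    (hs : T ≤ s) (hst : s ≤ t) {W w : ℝ → ℝ} (hW : ContDiff ℝ 1 W)
    (hw : ∀ p, HasDerivAt W (w p) p)
    (hle : ∀ u ∈ Ioo s t, -(Real.exp (P u - c) * (b u * y (h u))) ≤ a u * w (P u - c)) :
    Real.exp (P t - c) * y t - W (P t - c) ≤ Real.exp (P s - c) * y s - W (P s - c) := by
  have hP := (S.absCont_primitive s t hs hst).fun_sub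
    (contDiff_const (c := c)).contDiffOn.absolutelyContinuousOnInterval
  obtain ⟨C, hC⟩ := hP.exists_bound
  have hWP := absolutelyContinuousOnInterval_comp_contDiffOn (m := -C) (M := C) hP
    hW.contDiffOn fun t ht => abs_le.1 (hC t ht)
  -- With the integrating factor, `e^(P - c) y` has derivative `-e^(P - c) b y(h)`, so `hle` makes
  -- the difference nonincreasing.
  refine le_of_ae_hasDerivAt_nonpos hst ((S.absCont_exp_mul c hs hst).fun_sub hWP) ?_
  filter_upwards [S.deriv_primitive, S.deriv_eq] with u hPu hyu hu
  have hT := hs.trans hu.1.le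
  have h1 := (hPu hT).sub_const c
  refine ⟨_, (h1.exp.mul (hyu hT)).sub ((hw _).comp u h1), ?_⟩
  linarith [hle u hu]

theorem neg_term_le (S : IsDelaySolution T h₀ a₀ q H a b h P y) {u : ℝ}
    (hu : T ≤ u) (c : ℝ) {L : ℝ} (hL : 0 ≤ L) (hy : -L ≤ y (h u)) :
    -(Real.exp (P u - c) * (b u * y (h u))) ≤ a u * (q * L * Real.exp (P u - c)) := by
  obtain ⟨hb0, hb⟩ := S.coeff_mem u hu
  have hE := Real.exp_pos (P u - c)
  calc -(Real.exp (P u - c) * (b u * y (h u)))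
      = Real.exp (P u - c) * (b u * -y (h u)) := by ring
    _ ≤ Real.exp (P u - c) * (b u * L) := by gcongr; linarith
    _ ≤ Real.exp (P u - c) * (q * a u * L) := by gcongr
    _ = _ := by ring

/-- The bound `|y(h)| ≤ L` limits how fast `e^P y` can rise, so shortly before its zero `y` cannot
lie far below zero. -/
theorem neg_le_backward (S : IsDelaySolution T h₀ a₀ q H a b h P y) {L : ℝ}
    (hL : 0 ≤ L) (hy : ∀ t, T ≤ t → |y t| ≤ L) {s t₀ : ℝ} (hs : T + h₀ ≤ s) (hst : s ≤ t₀)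
    (hzero : y t₀ = 0) : -y s ≤ q * L * (Real.exp (P t₀ - P s) - 1) := by
  have h0 := S.delay_nonneg
  have := S.exp_mul_sub_le (P s) (s := s) (t := t₀) (by linarith) hst
    (W := fun p => q * L * Real.exp p) (w := fun p => q * L * Real.exp p)
    (by fun_prop) (fun p => (Real.hasDerivAt_exp p).const_mul _) ?_
  · simp only [hzero, sub_self, Real.exp_zero] at this
    linarith
  · intro u hu
    have hT : T + h₀ ≤ u := hs.trans hu.1.le
    exact S.neg_term_le (by linarith) (P s) hL
      (abs_le.1 (hy (h u) (by linarith [(S.delay_mem u (by linarith)).1]))).1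

/-- The solution on `(t₀, t₁]` after a zero `t₀`, while it stays positive. -/
theorem le_forward (S : IsDelaySolution T h₀ a₀ q H a b h P y) (ha₀ : 0 < a₀)
    (hq : 1 ≤ q) (hH : 1 + 1 / q ≤ Real.exp H) {L : ℝ}
    (hL : 0 ≤ L) (hy : ∀ t, T ≤ t → |y t| ≤ L) {t₀ t₁ : ℝ} (ht₀ : T + 2 * h₀ ≤ t₀) (ht : t₀ ≤ t₁)
    (hzero : y t₀ = 0) (hpos : ∀ t, t₀ < t → t ≤ t₁ → 0 < y t) (hP : P t₁ - P t₀ ≤ H)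
    (hcond : q * Real.exp H * Real.log ((q ^ 2 + q) / (q ^ 2 + 1)) ≤ 1) :
    y t₁ ≤ L * (1 - Real.exp (-H) * q *
      (1 - q * Real.exp H * Real.log ((q ^ 2 + q) / (q ^ 2 + 1)))) := by
  have h0 := S.delay_nonneg
  have hq0 : 0 < q := by linarith
  have hcontP : ContinuousOn P (Icc t₀ t₁) := by
    simpa [uIcc_of_le ht] using (S.absCont_primitive t₀ t₁ (by linarith) ht).continuousOn
  have hmono := S.primitive_le ha₀ (s := t₀) (t := t₁) (by linarith) ht
  -- `τ` is where the two growth bounds agree: `q e^τ = q² (e^H - e^τ)`. The hypothesis `hH` is `τ ≥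
  -- 0`.
  set τ := H - Real.log (1 + 1 / q) with hτ
  have hlog : Real.log (1 + 1 / q) ≤ H := by
    rw [← Real.log_exp H]; exact Real.log_le_log (by positivity) hH
  have hτ0 : 0 ≤ τ := by linarith
  have hexpτ : Real.exp τ * (q + 1) = Real.exp H * q := by
    rw [hτ, Real.exp_sub, Real.exp_log (by positivity)]
    field_simp
  set ℓ := Real.log ((q ^ 2 + q) / (q ^ 2 + 1)) with hℓ
  have hE := Real.exp_pos (P t₁ - P t₀)
  have hEH : Real.exp (-H) * Real.exp (P t₁ - P t₀) ≤ 1 := by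
    rw [← Real.exp_add, Real.exp_le_one_iff]; linarith
  have hEH' : Real.exp (-H) * Real.exp H = 1 := by rw [← Real.exp_add]; simp
  have phase1 : ∀ t, t₀ ≤ t → t ≤ t₁ → Real.exp (P t - P t₀) * y t ≤
      q * L * (Real.exp (P t - P t₀) - 1) := by
    intro t ht0 ht1
    have := S.exp_mul_sub_le (P t₀) (s := t₀) (t := t) (by linarith) ht0
      (W := fun p => q * L * Real.exp p) (w := fun p => q * L * Real.exp p)
      (by fun_prop) (fun p => (Real.hasDerivAt_exp p).const_mul _) (fun u hu =>
        S.neg_term_le (by linarith [hu.1]) (P t₀) hL (abs_le.1 (hy (h u)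
          (by linarith [hu.1, (S.delay_mem u (by linarith [hu.1])).1]))).1)
    simp only [hzero, sub_self, Real.exp_zero] at this
    linarith
  -- If `h u` is past `t₀`, the delayed term has the favourable sign. Otherwise `neg_le_backward`
  -- applies at `h u`, and the delay bound turns `e^(P t₀ - P (h u))` into at most `e^(H - p)`.
  have phase2 : ∀ s, t₀ ≤ s → s ≤ t₁ →
      Real.exp (P t₁ - P t₀) * y t₁ - q ^ 2 * L * (Real.exp H * (P t₁ - P t₀)
        - Real.exp (P t₁ - P t₀)) ≤
      Real.exp (P s - P t₀) * y s - q ^ 2 * L * (Real.exp H * (P s - P t₀)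
        - Real.exp (P s - P t₀)) := by
    intro s hs0 hs1
    refine S.exp_mul_sub_le (P t₀) (s := s) (t := t₁) (by linarith) hs1
      (W := fun p => q ^ 2 * L * (Real.exp H * p - Real.exp p))
      (w := fun p => q ^ 2 * L * (Real.exp H - Real.exp p))
      (by fun_prop) (fun p => ?_) (fun u hu => ?_)
    · simpa using (((hasDerivAt_id' p).const_mul (Real.exp H)).sub
        (Real.hasDerivAt_exp p)).const_mul (q ^ 2 * L)
    · have hu0 : t₀ < u := by linarith [hu.1]
      have hTu : T ≤ u := by linarith
      have hau : 0 < a u := ha₀.trans_le (S.le_rate u hTu)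
      obtain ⟨hb0, hb⟩ := S.coeff_mem u hTu
      have hEu := Real.exp_pos (P u - P t₀)
      have hPu : P u - P t₀ ≤ H := by
        linarith [S.primitive_le ha₀ (s := u) (t := t₁) hTu hu.2.le]
      have hEuH : Real.exp (P u - P t₀) ≤ Real.exp H := Real.exp_le_exp.2 hPu
      rcases lt_or_ge t₀ (h u) with hlt | hge
      · have h1 : 0 < y (h u) :=
          hpos _ hlt ((S.delay_mem u hTu).2.trans hu.2.le)
        have h2 : 0 ≤ Real.exp (P u - P t₀) * (b u * y (h u)) := by positivity
        have h3 : 0 ≤ a u * (q ^ 2 * L * (Real.exp H - Real.exp (P u - P t₀))) := by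
          have := sub_nonneg.2 hEuH
          positivity
        linarith
      · have h1 := S.neg_le_backward hL hy (s := h u) (t₀ := t₀)
          (by linarith [(S.delay_mem u hTu).1]) hge hzero
        have h2 : Real.exp (P t₀ - P (h u)) * Real.exp (P u - P t₀) ≤ Real.exp H := by
          rw [← Real.exp_add]
          exact Real.exp_le_exp.2 (by linarith [S.primitive_delay u (by linarith)])
        have h3 : 1 ≤ Real.exp (P t₀ - P (h u)) := by
          refine Real.one_le_exp (sub_nonneg.2 (S.primitive_le ha₀ ?_ hge))
          linarith [(S.delay_mem u hTu).1]
        have h4 : 0 ≤ q * L * (Real.exp (P t₀ - P (h u)) - 1) := by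
          have := sub_nonneg.2 h3
          positivity
        calc -(Real.exp (P u - P t₀) * (b u * y (h u)))
            = Real.exp (P u - P t₀) * (b u * -y (h u)) := by ring
          _ ≤ Real.exp (P u - P t₀) * (b u * (q * L * (Real.exp (P t₀ - P (h u)) - 1))) := by
              gcongr
          _ ≤ Real.exp (P u - P t₀) *
                (q * a u * (q * L * (Real.exp (P t₀ - P (h u)) - 1))) := by gcongr
          _ = a u * (q ^ 2 * L * (Real.exp (P t₀ - P (h u)) * Real.exp (P u - P t₀)
                - Real.exp (P u - P t₀))) := by ring
          _ ≤ _ := by gcongr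
  have hℓτ : H - Real.log (1 + 1 / q ^ 2) - τ = ℓ := by
    rw [hτ, hℓ, show (q ^ 2 + q) / (q ^ 2 + 1) = (1 + 1 / q) / (1 + 1 / q ^ 2) by field_simp,
      Real.log_div (by positivity) (by positivity)]
    ring
  -- The tangent line to `exp` at `τ + ℓ = H - ln (1 + 1 / q²)`; this is the spliced estimate after
  -- clearing common terms, with equality at the worst `p`.
  have hpeak : ∀ p, q ^ 2 * Real.exp H * (1 + (p - τ - ℓ)) ≤ (1 + q ^ 2) * Real.exp p := by
    intro p
    have h1 := Real.add_one_le_exp (p - τ - ℓ)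
    have h2 : Real.exp p = Real.exp (p - τ - ℓ) * (Real.exp H * q ^ 2 / (1 + q ^ 2)) := by
      have : Real.exp H * q ^ 2 / (1 + q ^ 2) = Real.exp (H - Real.log (1 + 1 / q ^ 2)) := by
        rw [Real.exp_sub, Real.exp_log (by positivity)]
        field_simp
        ring
      rw [this, ← Real.exp_add]
      congr 1
      linarith
    have h3 : (1 + q ^ 2) * Real.exp p = q ^ 2 * Real.exp H * Real.exp (p - τ - ℓ) := by
      rw [h2]; field_simp
    rw [h3]
    have := Real.exp_pos H
    gcongr
    linarith
  have hgoal : Real.exp (P t₁ - P t₀) * y t₁ ≤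
      L * (Real.exp (P t₁ - P t₀) - q * (1 - q * Real.exp H * ℓ)) := by
    rcases le_or_gt (P t₁ - P t₀) τ with hle | hgt
    -- Only the first bound is used here. It suffices that `(q - 1) e^p ≤ q² e^H ℓ`; as `q ≥ 1` the
    -- case `p = τ` is the worst, and there `hpeak` gives it.
    · have h1 := phase1 t₁ ht le_rfl
      have h2 : Real.exp (P t₁ - P t₀) ≤ Real.exp τ := Real.exp_le_exp.2 hle
      have h3 : (q - 1) * Real.exp (P t₁ - P t₀) ≤ (q - 1) * Real.exp τ :=
        mul_le_mul_of_nonneg_left h2 (by linarith)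
      have h4 := hpeak τ
      have h5 : q * (Real.exp (P t₁ - P t₀) - 1) ≤
          Real.exp (P t₁ - P t₀) - q * (1 - q * Real.exp H * ℓ) := by
        nlinarith [mul_comm (Real.exp H) q]
      have h6 := mul_le_mul_of_nonneg_left h5 hL
      linarith
    · obtain ⟨s, hs, hPs⟩ := intermediate_value_Icc ht (hcontP.sub continuousOn_const)
        (show τ ∈ Icc (P t₀ - P t₀) (P t₁ - P t₀) from ⟨by simpa using hτ0, hgt.le⟩)
      simp only [Pi.sub_apply] at hPs
      have h1 := phase1 s hs.1 hs.2
      have h2 := phase2 s hs.1 hs.2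
      have h4 := hpeak (P t₁ - P t₀)
      rw [hPs] at h1 h2
      have h5 := mul_le_mul_of_nonneg_left h4 hL
      have h6 : L * q * (Real.exp τ * (q + 1)) = L * q * (Real.exp H * q) := by rw [hexpτ]
      linarith
  have hG : 0 ≤ q * (1 - q * Real.exp H * ℓ) := mul_nonneg hq0.le (sub_nonneg.2 hcond)
  have hexp : Real.exp (-(P t₁ - P t₀)) * Real.exp (P t₁ - P t₀) = 1 := by
    rw [← Real.exp_add]; simp
  calc y t₁ = Real.exp (-(P t₁ - P t₀)) * (Real.exp (P t₁ - P t₀) * y t₁) := by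
        rw [← mul_assoc, hexp, one_mul]
    _ ≤ Real.exp (-(P t₁ - P t₀)) *
        (L * (Real.exp (P t₁ - P t₀) - q * (1 - q * Real.exp H * ℓ))) := by gcongr
    _ = L * (Real.exp (-(P t₁ - P t₀)) * Real.exp (P t₁ - P t₀) -
        Real.exp (-(P t₁ - P t₀)) * (q * (1 - q * Real.exp H * ℓ))) := by ring
    _ ≤ L * (1 - Real.exp (-H) * (q * (1 - q * Real.exp H * ℓ))) := by
        rw [hexp]; gcongr
    _ = _ := by ring

/-- Once `P` has advanced by `H` past the zero, the delay no longer reaches before `t₀`, so both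
terms of `y'` are nonpositive and `y` cannot grow. The bound at the moment of advance `H` therefore
persists. -/
theorem le_after_zero (S : IsDelaySolution T h₀ a₀ q H a b h P y) (ha₀ : 0 < a₀)
    (hq : 1 ≤ q) (hH : 1 + 1 / q ≤ Real.exp H) {L : ℝ}
    (hL : 0 ≤ L) (hy : ∀ t, T ≤ t → |y t| ≤ L) {t₀ t₁ : ℝ} (ht₀ : T + 2 * h₀ ≤ t₀) (ht : t₀ ≤ t₁)
    (hzero : y t₀ = 0) (hpos : ∀ t, t₀ < t → t ≤ t₁ → 0 < y t)
    (hcond : q * Real.exp H * Real.log ((q ^ 2 + q) / (q ^ 2 + 1)) ≤ 1) :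
    y t₁ ≤ L * (1 - Real.exp (-H) * q *
      (1 - q * Real.exp H * Real.log ((q ^ 2 + q) / (q ^ 2 + 1)))) := by
  rcases le_or_gt (P t₁ - P t₀) H with hP | hP
  · exact S.le_forward ha₀ hq hH hL hy ht₀ ht hzero hpos hP hcond
  have h0 := S.delay_nonneg
  have hcontP : ContinuousOn P (Icc t₀ t₁) := by
    simpa [uIcc_of_le ht] using (S.absCont_primitive t₀ t₁ (by linarith) ht).continuousOn
  have hH0 : 0 ≤ H := by
    have : 0 ≤ 1 / q := by positivity
    exact Real.exp_le_exp.1 (by rw [Real.exp_zero]; linarith)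
  obtain ⟨s, hs, hPs⟩ := intermediate_value_Icc ht (hcontP.sub continuousOn_const)
    (show H ∈ Icc (P t₀ - P t₀) (P t₁ - P t₀) from ⟨by simpa using hH0, hP.le⟩)
  simp only [Pi.sub_apply] at hPs
  refine le_trans ?_ (S.le_forward ha₀ hq hH hL hy ht₀ hs.1 hzero
    (fun t h1 h2 => hpos t h1 (h2.trans hs.2)) hPs.le hcond)
  refine le_of_ae_hasDerivAt_nonpos hs.2 (S.absCont s t₁ (by linarith [hs.1]) hs.2) ?_
  filter_upwards [S.deriv_eq] with u hu hm
  have hu0 : t₀ < u := hs.1.trans_lt hm.1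
  have hTu : T ≤ u := by linarith
  refine ⟨_, hu hTu, ?_⟩
  have h1 : t₀ ≤ h u := by
    by_contra! hlt
    have h2 := S.primitive_delay u (by linarith)
    have h3 := S.primitive_le ha₀ (s := s) (t := u) (by linarith [hs.1]) hm.1.le
    have h4 := S.mul_le_primitive_sub (s := h u) (t := t₀)
      (by linarith [(S.delay_mem u hTu).1]) hlt.le
    have h5 := mul_pos ha₀ (sub_pos.2 hlt)
    linarith
  have h2 : 0 ≤ y (h u) := by
    rcases h1.eq_or_lt with h1 | h1
    · rw [← h1, hzero]
    · exact (hpos _ h1 ((S.delay_mem u hTu).2.trans hm.2.le)).le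
  have h3 := mul_nonneg (S.coeff_mem u hTu).1 h2
  have h4 := mul_nonneg (ha₀.le.trans (S.le_rate u hTu)) (hpos u hu0 hm.2.le).le
  linarith

/-- After a late zero, every positive value belongs to an excursion starting at a zero, where
`le_after_zero` applies. Without late zeros the sign is constant. The offset `2 * h₀` allows for two
delays: one in the equation, one inside `neg_le_backward`. -/
theorem exists_forall_ge_le (S : IsDelaySolution T h₀ a₀ q H a b h P y) (ha₀ : 0 < a₀)
    (hq : 1 ≤ q) (hH : 1 + 1 / q ≤ Real.exp H) {L ρ : ℝ}
    (hL : 0 < L) (hy : ∀ t, T ≤ t → |y t| ≤ L)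
    (hcond : q * Real.exp H * Real.log ((q ^ 2 + q) / (q ^ 2 + 1)) ≤ 1) (hρ0 : 0 < ρ)
    (hρ : 1 - Real.exp (-H) * q *
      (1 - q * Real.exp H * Real.log ((q ^ 2 + q) / (q ^ 2 + 1))) ≤ ρ) :
    ∃ T' ≥ T, ∀ t ≥ T', y t ≤ ρ * L := by
  have h0 := S.delay_nonneg
  have hρL : 0 < ρ * L := by positivity
  have hcont : ∀ s t, T ≤ s → s ≤ t → ContinuousOn y (Icc s t) := fun s t hs hst => by
    simpa [uIcc_of_le hst] using (S.absCont s t hs hst).continuousOn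
  by_cases hz : ∃ s ≥ T + 2 * h₀, y s = 0
  · obtain ⟨s, hs, hys⟩ := hz
    refine ⟨s, by linarith, fun t ht => ?_⟩
    rcases le_or_gt (y t) 0 with hyt | hyt
    · linarith
    have hcl : IsClosed ({u | y u ≤ 0} ∩ Icc s t) := by
      rw [inter_comm]
      exact (hcont s t (by linarith) ht).preimage_isClosed_of_isClosed isClosed_Icc isClosed_Iic
    obtain ⟨c, hc, hsc, hct, hlast⟩ := exists_last_mem hcl hys.le ht
    obtain ⟨z, hz, hyz⟩ := intermediate_value_Icc hct (hcont c t (by linarith) hct)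
      (show (0 : ℝ) ∈ Icc (y c) (y t) from ⟨hc, hyt.le⟩)
    refine (S.le_after_zero ha₀ hq hH hL.le hy (t₀ := z) (by linarith [hz.1]) hz.2 hyz
      (fun u h1 h2 => not_le.1 (hlast u (hz.1.trans_lt h1) h2)) hcond).trans ?_
    rw [mul_comm]
    gcongr
  · push Not at hz
    rcases lt_or_gt_of_ne (hz _ le_rfl) with hneg | hpos
    · refine ⟨T + 2 * h₀, by linarith, fun t ht => ?_⟩
      by_contra! hlt
      obtain ⟨z, hz1, hz2⟩ := intermediate_value_Icc ht (hcont _ _ (by linarith) ht)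
        (show (0 : ℝ) ∈ Icc (y (T + 2 * h₀)) (y t) from ⟨hneg.le, by linarith⟩)
      exact hz z hz1.1 hz2
    · have hall : ∀ t, T + 2 * h₀ ≤ t → 0 < y t := by
        intro t ht
        by_contra! hle
        obtain ⟨z, hz1, hz2⟩ := intermediate_value_Icc' ht (hcont _ _ (by linarith) ht)
          (show (0 : ℝ) ∈ Icc (y t) (y (T + 2 * h₀)) from ⟨hle, hpos.le⟩)
        exact hz z hz1.1 hz2
      -- From `T + 3 * h₀` on the delayed value is positive too, so `y' ≤ -a₀ ρ L` as long as `y > ρ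
      -- L`.
      obtain ⟨T', hT', h'⟩ := eventually_le_of_ae_deriv (x := y) (T := T + 3 * h₀) (m := ρ * L)
        (δ := a₀ * (ρ * L)) (by positivity) (fun s t hs => S.absCont s t (by linarith)) (by
          filter_upwards [S.deriv_eq] with u hu hTu hlt
          have hT : T ≤ u := by linarith
          refine ⟨_, hu hT, ?_⟩
          have h1 := mul_nonneg (S.coeff_mem u hT).1
            (hall (h u) (by linarith [(S.delay_mem u hT).1])).le
          have h2 : a₀ * (ρ * L) ≤ a u * y u :=
            mul_le_mul (S.le_rate u hT) hlt.le hρL.le (ha₀.le.trans (S.le_rate u hT))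
          linarith)
      exact ⟨T', by linarith, h'⟩

theorem tendsto_zero_of_one_le (S : IsDelaySolution T h₀ a₀ q H a b h P y) (ha₀ : 0 < a₀)
    (hq : 1 ≤ q) (hH : 1 + 1 / q ≤ Real.exp H) {L : ℝ} (hy : ∀ t, T ≤ t → |y t| ≤ L)
    (hcond : q * Real.exp H * Real.log ((q ^ 2 + q) / (q ^ 2 + 1)) < 1) :
    Tendsto y atTop (𝓝 0) := by
  -- The maximum with `1 / 2` only ensures `ρ > 0`.
  set ρ := max (1 / 2) (1 - Real.exp (-H) * q *
      (1 - q * Real.exp H * Real.log ((q ^ 2 + q) / (q ^ 2 + 1)))) with hρ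
  have hρ0 : 0 < ρ := lt_max_of_lt_left (by norm_num)
  have hρ1 : ρ < 1 := by
    refine max_lt (by norm_num) ?_
    have := mul_pos (mul_pos (Real.exp_pos (-H)) (by linarith : 0 < q)) (sub_pos.2 hcond)
    linarith
  have hL : 0 < max L 1 := lt_max_of_lt_right one_pos
  have hiter : ∀ k : ℕ, ∃ T' ≥ T, ∀ t ≥ T', |y t| ≤ ρ ^ k * max L 1 := by
    intro k
    induction k with
    | zero => exact ⟨T, le_rfl, fun t ht => by simpa using Or.inl (hy t ht)⟩
    | succ k ih =>
      obtain ⟨T', hT', h'⟩ := ih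
      have hLk : 0 < ρ ^ k * max L 1 := by positivity
      obtain ⟨T₁, hT₁, h₁⟩ := (S.mono hT').exists_forall_ge_le ha₀ hq hH hLk h' hcond.le hρ0
        (le_max_right _ _)
      obtain ⟨T₂, hT₂, h₂⟩ := (S.mono hT').neg.exists_forall_ge_le ha₀ hq hH hLk
        (fun t ht => by simpa using h' t ht) hcond.le hρ0 (le_max_right _ _)
      refine ⟨max T₁ T₂, hT'.trans (hT₁.trans (le_max_left _ _)), fun t ht => ?_⟩
      have e : ρ ^ (k + 1) * max L 1 = ρ * (ρ ^ k * max L 1) := by ring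
      rw [e]
      exact abs_le'.2 ⟨h₁ t (le_of_max_le_left ht), h₂ t (le_of_max_le_right ht)⟩
  have hlim : Tendsto (fun k : ℕ => ρ ^ k * max L 1) atTop (𝓝 0) := by
    simpa using (tendsto_pow_atTop_nhds_zero_of_lt_one hρ0.le hρ1).mul_const (max L 1)
  rw [Metric.tendsto_atTop]
  intro ε hε
  obtain ⟨k, hk⟩ := (hlim.eventually (gt_mem_nhds hε)).exists
  obtain ⟨T', -, h'⟩ := hiter k
  exact ⟨T', fun t ht => by simpa [Real.dist_eq] using (h' t ht).trans_lt hk⟩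

/-- Raising `q` to at least `1` and `H` to at least `ln (1 + 1 / q)` keeps the structure and does
not spoil the condition: for `q = 1` the logarithm vanishes, and for `H = ln (1 + 1 / q)` the
inequality `ln z ≤ z - 1` bounds the left side by `(q² - 1) / (q² + 1)`. -/
theorem tendsto_zero (S : IsDelaySolution T h₀ a₀ q H a b h P y) (ha₀ : 0 < a₀) (hq : 0 < q)
    {L : ℝ} (hy : ∀ t, T ≤ t → |y t| ≤ L)
    (hcond : q * Real.exp H * Real.log ((q ^ 2 + q) / (q ^ 2 + 1)) < 1) :
    Tendsto y atTop (𝓝 0) := by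
  set q' := max q 1 with hq'
  have hq1 : 1 ≤ q' := le_max_right _ _
  have hq0 : 0 < q' := by linarith
  set H' := max H (Real.log (1 + 1 / q')) with hH'
  have S' : IsDelaySolution T h₀ a₀ q' H' a b h P y :=
    { S with
      coeff_mem := fun t ht => ⟨(S.coeff_mem t ht).1, (S.coeff_mem t ht).2.trans
        (mul_le_mul_of_nonneg_right (le_max_left _ _) (ha₀.le.trans (S.le_rate t ht)))⟩
      primitive_delay := fun t ht => (S.primitive_delay t ht).trans (le_max_left _ _) }
  refine S'.tendsto_zero_of_one_le ha₀ hq1 ?_ hy ?_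
  · rw [← Real.exp_log (show 0 < 1 + 1 / q' by positivity)]
    exact Real.exp_le_exp.2 (le_max_right _ _)
  · rcases le_total H (Real.log (1 + 1 / q')) with hle | hle
    · rw [hH', max_eq_right hle, Real.exp_log (by positivity)]
      have h1 := Real.log_le_sub_one_of_pos (show 0 < (q' ^ 2 + q') / (q' ^ 2 + 1) by positivity)
      calc q' * (1 + 1 / q') * Real.log ((q' ^ 2 + q') / (q' ^ 2 + 1))
          ≤ q' * (1 + 1 / q') * ((q' ^ 2 + q') / (q' ^ 2 + 1) - 1) := by gcongr
        _ = (q' ^ 2 - 1) / (q' ^ 2 + 1) := by field_simp; ring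
        _ < 1 := by rw [div_lt_one (by positivity)]; linarith
    · rw [hH', max_eq_left hle]
      rcases le_total q 1 with h1 | h1
      · rw [hq', max_eq_right h1]; norm_num
      · rwa [hq', max_eq_left h1]

end IsDelaySolution
-- The Hill function and the quotient `(1 - e^(-v)) / v`
/-- The Hill function `u^n / (1 + u^n)`. -/
noncomputable def hill (n u : ℝ) : ℝ := u ^ n / (1 + u ^ n)

theorem hill_nonneg {n u : ℝ} (hu : 0 ≤ u) : 0 ≤ hill n u := by
  have := Real.rpow_nonneg hu n
  exact div_nonneg this (by linarith)

theorem hill_pos {n u : ℝ} (hu : 0 < u) : 0 < hill n u := by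
  have := Real.rpow_pos_of_pos hu n
  exact div_pos this (by linarith)

theorem hill_lt_one {n u : ℝ} (hu : 0 ≤ u) : hill n u < 1 := by
  have := Real.rpow_nonneg hu n
  rw [hill, div_lt_one (by linarith)]
  linarith

theorem hill_lt_hill {n u v : ℝ} (hn : 0 < n) (hu : 0 ≤ u) (huv : u < v) :
    hill n u < hill n v := by
  have h1 := Real.rpow_nonneg hu n
  have h2 := Real.rpow_lt_rpow hu huv hn
  rw [hill, hill, div_lt_div_iff₀ (by linarith) (by linarith)]
  linarith

theorem hill_le_hill {n u v : ℝ} (hn : 0 < n) (hu : 0 ≤ u) (huv : u ≤ v) :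
    hill n u ≤ hill n v := by
  rcases huv.eq_or_lt with rfl | h
  · exact le_rfl
  · exact (hill_lt_hill hn hu h).le

/-- In the variable `v` the Hill function is logistic, with slope `n w / (1 + w)²` for `w = K^n e^(n
v)`. This lies in `[0, n / 4]` because `4 w ≤ (1 + w)²`; the secant slope `θ` inherits the bounds.
It is the source of `b₀ = β n R / 4`. -/
theorem exists_hill_exp_sub_eq {n K : ℝ} (hn : 0 < n) (hK : 0 < K) (v : ℝ) :
    ∃ θ, 0 ≤ θ ∧ θ ≤ n / 4 ∧ hill n (K * Real.exp v) - hill n K = θ * v := by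
  set k := K ^ n with hk
  have hk0 : 0 < k := Real.rpow_pos_of_pos hK n
  set g : ℝ → ℝ := fun v => 1 - 1 / (1 + k * Real.exp (n * v)) with hg
  have hden : ∀ v, 0 < 1 + k * Real.exp (n * v) := fun v => by positivity
  have hgv : ∀ v, hill n (K * Real.exp v) = g v := fun v => by
    have := hden v
    rw [hill, Real.mul_rpow hK.le (Real.exp_pos v).le, ← Real.exp_mul, mul_comm v n]
    simp only [hg]
    field_simp
    ring
  have hg0 : hill n K = g 0 := by simpa using hgv 0
  have hd : ∀ v, HasDerivAt g (n * (k * Real.exp (n * v)) / (1 + k * Real.exp (n * v)) ^ 2) v := by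
    intro v
    have h1 : HasDerivAt (fun v => 1 + k * Real.exp (n * v)) (k * (Real.exp (n * v) * n)) v := by
      simpa using ((((hasDerivAt_id' v).const_mul n).exp).const_mul k).const_add 1
    have h2 := (h1.inv (hden v).ne').const_sub 1
    simp only [hg, one_div]
    exact h2.congr_deriv (by ring)
  have hmono : Monotone g := monotone_of_hasDerivAt_nonneg hd fun v => by
    simp only [Pi.zero_apply]; positivity
  have hmono' : Monotone fun v => n / 4 * v - g v := by
    refine monotone_of_hasDerivAt_nonneg
      (fun v => ((hasDerivAt_id' v).const_mul (n / 4)).sub (hd v)) fun v => ?_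
    simp only [Pi.zero_apply]
    rw [sub_nonneg, div_le_iff₀ (pow_pos (hden v) 2)]
    nlinarith [mul_nonneg hn.le (sq_nonneg (k * Real.exp (n * v) - 1))]
  rw [hgv, hg0]
  rcases lt_trichotomy v 0 with h | h | h
  · have h1 := hmono h.le
    have h2 := hmono' h.le
    simp only at h2
    exact ⟨(g v - g 0) / v, div_nonneg_of_nonpos (by linarith) h.le,
      by rw [div_le_iff_of_neg h]; linarith, (div_mul_cancel₀ _ h.ne).symm⟩
  · exact ⟨0, le_rfl, by positivity, by simp [h]⟩
  · have h1 := hmono h.le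
    have h2 := hmono' h.le
    simp only at h2
    exact ⟨(g v - g 0) / v, div_nonneg (by linarith) h.le,
      by rw [div_le_iff₀ h]; linarith, by field_simp⟩

/-- The function `(1 - e^(-v)) / v`, continuously extended to `v = 0`. -/
noncomputable def expQuotient (v : ℝ) : ℝ := if v = 0 then 1 else (1 - Real.exp (-v)) / v

theorem expQuotient_mul (v : ℝ) : expQuotient v * v = 1 - Real.exp (-v) := by
  unfold expQuotient
  split_ifs with h
  · simp [h]
  · field_simp

theorem measurable_expQuotient : Measurable expQuotient :=
  Measurable.ite (measurableSet_singleton 0) measurable_const (by fun_prop)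

/-- The value at `v` is the slope of the secant of `exp` between `0` and `-v`, monotone by
convexity. This turns `c ≤ y ≤ C` into bounds on `a`. -/
theorem expQuotient_antitone : Antitone expQuotient := by
  intro u v huv
  unfold expQuotient
  split_ifs with h1 h2 h2
  · exact le_rfl
  · have hu : u < 0 := lt_of_le_of_ne (huv.trans h1.le) h2
    rw [le_div_iff_of_neg hu]
    linarith [Real.add_one_le_exp (-u)]
  · have hv : 0 < v := lt_of_le_of_ne (h2.symm.le.trans huv) (Ne.symm h1)
    rw [div_le_one hv]
    linarith [Real.add_one_le_exp (-v)]
  · have := convexOn_exp.secant_mono (a := 0) (x := -v) (y := -u) (mem_univ _) (mem_univ _)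
      (mem_univ _) (neg_ne_zero.2 h1) (neg_ne_zero.2 h2) (by linarith)
    rw [Real.exp_zero, sub_zero, sub_zero] at this
    calc (1 - Real.exp (-v)) / v = (Real.exp (-v) - 1) / -v := by rw [div_neg, ← neg_div]; ring
      _ ≤ (Real.exp (-u) - 1) / -u := this
      _ = _ := by rw [div_neg, ← neg_div]; ring

theorem expQuotient_pos (v : ℝ) : 0 < expQuotient v := by
  unfold expQuotient
  split_ifs with h
  · exact one_pos
  · rcases lt_or_gt_of_ne h with h | h
    · exact div_pos_of_neg_of_neg (by simpa using h) h
    · exact div_pos (by simpa using h) h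

/-! ### The equilibrium and the bounds `μ < K < M` -/

theorem upperBound_mul_hill {α β n : ℝ} (hα : 0 < α) (hβ : 0 < β) :
    upperBound α β n * hill n (α / β) = α / β := by
  have hμ : 0 < α / β := div_pos hα hβ
  have h1 : (β / α) ^ n = ((α / β) ^ n)⁻¹ := by
    rw [← Real.inv_rpow hμ.le, inv_div]
  have h2 := Real.rpow_pos_of_pos hμ n
  rw [upperBound, hill, h1]
  field_simp
  ring

namespace IsPositiveEquilibrium

variable {α β n K : ℝ}

theorem mul_hill (hK : IsPositiveEquilibrium α β n K) : β * K * hill n K = α := by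
  have h1 := hK.2
  have h2 := Real.rpow_pos_of_pos hK.1 n
  rw [Real.rpow_add hK.1, Real.rpow_one] at h1
  rw [hill]
  field_simp
  linarith

theorem lowerBound_lt (hK : IsPositiveEquilibrium α β n K) (hβ : 0 < β) :
    lowerBound α β < K := by
  rw [lowerBound, div_lt_iff₀ hβ]
  have h1 := hK.mul_hill
  have := mul_lt_mul_of_pos_left (hill_lt_one (n := n) hK.1.le) (mul_pos hβ hK.1)
  linarith

theorem lt_upperBound (hK : IsPositiveEquilibrium α β n K) (hα : 0 < α) (hβ : 0 < β)
    (hn : 0 < n) : K < upperBound α β n := by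
  have hμ : 0 < α / β := div_pos hα hβ
  have h1 := hill_lt_hill hn hμ.le (hK.lowerBound_lt hβ)
  have h2 := hill_pos (n := n) hμ
  have h3 := upperBound_mul_hill (n := n) hα hβ
  have h4 : K * hill n K = α / β := by
    rw [eq_div_iff hβ.ne']; linarith [hK.mul_hill]
  refine lt_of_mul_lt_mul_right ?_ h2.le
  rw [h3]
  exact (mul_lt_mul_of_pos_left h1 hK.1).trans_eq h4

end IsPositiveEquilibrium

/-! ### Positivity and eventual bounds of solutions -/

namespace IsSolution

variable {α β n r₀ R h₀ : ℝ} {r h φ x : ℝ → ℝ}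

theorem absCont_of_nonneg (hx : IsSolution α β n r h φ x) {s t : ℝ} (hs : 0 ≤ s) (hst : s ≤ t) :
    AbsolutelyContinuousOnInterval x s t :=
  (hx.absCont t (hs.trans hst)).mono (by
    rw [uIcc_of_le hst, uIcc_of_le (hs.trans hst)]
    exact Icc_subset_Icc_left hs)

theorem ae_hasDerivAt (hx : IsSolution α β n r h φ x) :
    ∀ᵐ t, 0 ≤ t → HasDerivAt x (r t * (α - β * x t * hill n (x (h t)))) t := by
  have := (ae_restrict_iff' measurableSet_Ici).1 hx.deriv_eq
  filter_upwards [this] with t ht h0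
  simpa only [hill, mul_div_assoc] using ht h0

/-- While `0 < x < α / β` the Hill factor, being below `1`, leaves `x' ≥ 0`. Hence `x` cannot fall
to its first nonpositive value from its last visit above `α / β`, or from time `0`. -/
theorem pos (hx : IsSolution α β n r h φ x) (hα : 0 < α) (hβ : 0 < β)
    (hr : ∀ t : ℝ, 0 ≤ t → 0 ≤ r t) (hh : ∀ t : ℝ, 0 ≤ t → h t ≤ t)
    (hφ : ∀ t : ℝ, t ≤ 0 → 0 ≤ φ t) (hφ0 : 0 < φ 0) {t : ℝ} (ht : 0 ≤ t) : 0 < x t := by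
  by_contra! hxt
  have hcont : ContinuousOn x (Icc 0 t) := by
    simpa [uIcc_of_le ht] using (hx.absCont t ht).continuousOn
  have hx0 : 0 < x 0 := by rwa [hx.initial 0 le_rfl]
  have hcl : IsClosed (Icc 0 t ∩ x ⁻¹' Iic 0) :=
    hcont.preimage_isClosed_of_isClosed isClosed_Icc isClosed_Iic
  have hbdd : BddBelow (Icc 0 t ∩ x ⁻¹' Iic 0) := ⟨0, fun u hu => hu.1.1⟩
  obtain ⟨⟨hc0, hct⟩, hxc⟩ := hcl.csInf_mem ⟨t, ⟨ht, le_rfl⟩, hxt⟩ hbdd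
  set c := sInf (Icc 0 t ∩ x ⁻¹' Iic 0) with hc
  have hxc : x c ≤ 0 := hxc
  have hbefore : ∀ u, 0 ≤ u → u < c → 0 < x u := by
    intro u h0 huc
    by_contra! hle
    exact absurd (csInf_le hbdd ⟨⟨h0, huc.le.trans hct⟩, hle⟩) (not_le.2 huc)
  -- The alternative `u ≤ 0` puts time `0` in the set, so a last time exists even if `x` is never
  -- above `α / β`.
  have hcl' : IsClosed ({u | α / β ≤ x u ∨ u ≤ 0} ∩ Icc 0 c) := by
    have h1 : IsClosed (Icc 0 c ∩ x ⁻¹' Ici (α / β)) :=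
      (hcont.mono (Icc_subset_Icc_right hct)).preimage_isClosed_of_isClosed
        isClosed_Icc isClosed_Ici
    have h2 : {u | α / β ≤ x u ∨ u ≤ 0} ∩ Icc 0 c
        = (Icc 0 c ∩ x ⁻¹' Ici (α / β)) ∪ (Icc 0 c ∩ Iic 0) := by
      ext u
      simp only [mem_inter_iff, mem_ofPred_eq, mem_union, mem_preimage, mem_Ici, mem_Iic]
      tauto
    rw [h2]
    exact h1.union (isClosed_Icc.inter isClosed_Iic)
  obtain ⟨s, hs, hs0, hsc, hlast⟩ := exists_last_mem hcl' (Or.inr le_rfl) hc0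
  have hsx : 0 < x s := by
    rcases hs with h1 | h1
    · exact (div_pos hα hβ).trans_le h1
    · rwa [le_antisymm h1 hs0]
  have := le_of_ae_hasDerivAt_nonpos hsc (hx.absCont_of_nonneg hs0 hsc).fun_neg (by
    filter_upwards [hx.ae_hasDerivAt] with u hu hm
    have hu0 : 0 ≤ u := hs0.trans hm.1.le
    refine ⟨_, (hu hu0).neg, neg_nonpos.2 (mul_nonneg (hr u hu0) ?_)⟩
    have h1 : x u < α / β := by
      by_contra! h2
      exact hlast u hm.1 hm.2.le (Or.inl h2)
    rw [lt_div_iff₀ hβ] at h1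
    have h2 := hbefore u hu0 hm.2
    have h3 : 0 ≤ x (h u) := by
      rcases le_or_gt (h u) 0 with h4 | h4
      · rw [hx.initial _ h4]; exact hφ _ h4
      · exact (hbefore _ h4.le ((hh u hu0).trans_lt hm.2)).le
    have h5 : β * x u * hill n (x (h u)) ≤ β * x u * 1 := by
      have := (hill_lt_one (n := n) h3).le
      gcongr
    linarith)
  linarith

theorem exists_forall_ge (hx : IsSolution α β n r h φ x) (hβ : 0 < β) (hr₀ : 0 < r₀)
    (hr : ∀ t : ℝ, 0 ≤ t → r₀ ≤ r t) (hpos : ∀ t, 0 ≤ t → 0 < x t) {T f m : ℝ} (hT : 0 ≤ T)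
    (hf : ∀ t ≥ T, 0 ≤ hill n (x (h t)) ∧ hill n (x (h t)) ≤ f) (hm : β * m * f < α) :
    ∃ T' ≥ T, ∀ t ≥ T', m ≤ x t := by
  refine eventually_ge_of_ae_deriv (mul_pos hr₀ (sub_pos.2 hm))
    (fun s t hs => hx.absCont_of_nonneg (hT.trans hs)) ?_
  filter_upwards [hx.ae_hasDerivAt] with t ht hTt hlt
  refine ⟨_, ht (hT.trans hTt), ?_⟩
  have h0 := hpos t (hT.trans hTt)
  obtain ⟨hf0, hf1⟩ := hf t hTt
  have h1 : β * x t * hill n (x (h t)) ≤ β * m * f := by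
    have := h0.trans hlt
    gcongr
  exact mul_le_mul (hr t (hT.trans hTt)) (by linarith) (sub_pos.2 hm).le
    (hr₀.le.trans (hr t (hT.trans hTt)))

theorem exists_forall_le (hx : IsSolution α β n r h φ x) (hβ : 0 < β) (hr₀ : 0 < r₀)
    (hr : ∀ t : ℝ, 0 ≤ t → r₀ ≤ r t) {T f m : ℝ} (hT : 0 ≤ T) (hf0 : 0 ≤ f) (hm0 : 0 ≤ m)
    (hf : ∀ t ≥ T, f ≤ hill n (x (h t))) (hm : α < β * m * f) :
    ∃ T' ≥ T, ∀ t ≥ T', x t ≤ m := by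
  refine eventually_le_of_ae_deriv (mul_pos hr₀ (sub_pos.2 hm))
    (fun s t hs => hx.absCont_of_nonneg (hT.trans hs)) ?_
  filter_upwards [hx.ae_hasDerivAt] with t ht hTt hlt
  refine ⟨_, ht (hT.trans hTt), ?_⟩
  have hf1 := hf t hTt
  have h0 : 0 ≤ x t := hm0.trans hlt.le
  have h1 : β * m * f ≤ β * x t * hill n (x (h t)) := by gcongr
  have := mul_le_mul (hr t (hT.trans hTt)) (show β * m * f - α ≤
    β * x t * hill n (x (h t)) - α by linarith) (sub_pos.2 hm).le
    (hr₀.le.trans (hr t (hT.trans hTt)))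
  linarith

/-- The solution eventually enters `[μ, M]`. -/
theorem exists_forall_mem_Icc (hx : IsSolution α β n r h φ x) (hα : 0 < α) (hβ : 0 < β)
    (hn : 0 < n) (hr₀ : 0 < r₀) (hr : ∀ t : ℝ, 0 ≤ t → r₀ ≤ r t)
    (hh : ∀ t : ℝ, 0 ≤ t → h t ≤ t ∧ t - h t ≤ h₀) (hpos : ∀ t, 0 ≤ t → 0 < x t) :
    ∃ T ≥ 0, ∀ t ≥ T, x t ∈ Icc (lowerBound α β) (upperBound α β n) := by
  have h0 : 0 ≤ h₀ := by linarith [hh 0 le_rfl]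
  have hdelay : ∀ {T t}, T + h₀ ≤ t → 0 ≤ T → T ≤ h t := fun {T t} h1 h2 => by
    linarith [hh t (by linarith)]
  have hμ : 0 < α / β := div_pos hα hβ
  have hβμ : β * (α / β) = α := by field_simp
  -- A crude lower bound, then a crude upper bound; the latter separates the Hill factor from `1`.
  obtain ⟨T₁, hT₁, h₁⟩ := hx.exists_forall_ge hβ hr₀ hr hpos (T := h₀) (f := 1)
    (m := α / β / 2) h0 (fun t ht => by
      have := (hpos _ (hdelay (T := 0) (by simpa using ht) le_rfl)).le
      exact ⟨hill_nonneg this, (hill_lt_one this).le⟩) (by linarith)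
  have hT₁0 : 0 ≤ T₁ := h0.trans hT₁
  have hf₁ := hill_pos (n := n) (half_pos hμ)
  set f₁ := hill n (α / β / 2)
  obtain ⟨T₂, hT₂, h₂⟩ := hx.exists_forall_le hβ hr₀ hr (T := T₁ + h₀) (f := f₁)
    (m := 2 * (α / β) / f₁) (by linarith) hf₁.le (by positivity)
    (fun t ht => hill_le_hill hn (half_pos hμ).le (h₁ _ (hdelay ht hT₁0)))
    (by field_simp; linarith)
  have hT₂0 : 0 ≤ T₂ := by linarith
  have hB : 0 ≤ 2 * (α / β) / f₁ := by positivity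
  have hf₂ := hill_lt_one (n := n) hB
  have hf₂0 := hill_nonneg (n := n) hB
  set f₂ := hill n (2 * (α / β) / f₁)
  -- As `f₂ < 1`, the factor `2 / (1 + f₂)` exceeds `1` while its product with `f₂` stays below `1`.
  -- So `x` rises strictly above `μ`, and this margin makes the next inequality strict, with `M`
  -- reached in finite time.
  obtain ⟨T₃, hT₃, h₃⟩ := hx.exists_forall_ge hβ hr₀ hr hpos (T := T₂ + h₀) (f := f₂)
    (m := α / β * (2 / (1 + f₂))) (by linarith)
    (fun t ht => by
      have h4 := hdelay ht hT₂0
      have h5 := (hpos _ (hT₂0.trans h4)).le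
      exact ⟨hill_nonneg h5, hill_le_hill hn h5 (h₂ _ h4)⟩)
    (by
      rw [← mul_assoc, hβμ, mul_assoc, div_mul_eq_mul_div, mul_div_assoc', div_lt_iff₀ (by linarith)]
      gcongr
      linarith)
  have hT₃0 : 0 ≤ T₃ := by linarith
  have hlt : α / β < α / β * (2 / (1 + f₂)) := by
    refine lt_mul_of_one_lt_right hμ ?_
    rw [one_lt_div (by linarith)]
    linarith
  have hf₃ := hill_lt_hill hn hμ.le hlt
  have hμf := hill_pos (n := n) hμ
  have hM := upperBound_mul_hill (n := n) hα hβ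
  have hM0 : 0 < upperBound α β n := by
    by_contra! hle
    have := mul_nonpos_of_nonpos_of_nonneg hle hμf.le
    linarith
  obtain ⟨T₄, hT₄, h₄⟩ := hx.exists_forall_le hβ hr₀ hr (T := T₃ + h₀)
    (f := hill n (α / β * (2 / (1 + f₂)))) (m := upperBound α β n) (by linarith)
    (hμf.trans hf₃).le hM0.le
    (fun t ht => hill_le_hill hn (hμ.le.trans hlt.le) (h₃ _ (hdelay ht hT₃0)))
    (by
      calc α = β * (upperBound α β n * hill n (α / β)) := by rw [hM, hβμ]
        _ < β * (upperBound α β n * hill n (α / β * (2 / (1 + f₂)))) := by gcongr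
        _ = _ := by ring)
  exact ⟨T₄, by linarith, fun t ht => ⟨hlt.le.trans (h₃ t (by linarith)), h₄ t ht⟩⟩

end IsSolution
-- Reduction to the linear delay equation
/-- The logarithm of a solution, relative to the equilibrium, solves a linear delay equation. -/
theorem IsSolution.exists_isDelaySolution {α β n K r₀ R h₀ : ℝ} {r h φ x : ℝ → ℝ}
    (hx : IsSolution α β n r h φ x) (hα : 0 < α) (hβ : 0 < β) (hn : 0 < n)
    (hK : IsPositiveEquilibrium α β n K)
    (hr_meas : AEMeasurable r (volume.restrict (Ici (0 : ℝ))))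
    (hr₀ : 0 < r₀) (hr : ∀ t : ℝ, 0 ≤ t → r₀ ≤ r t ∧ r t ≤ R)
    (hh : ∀ t : ℝ, 0 ≤ t → h t ≤ t ∧ t - h t ≤ h₀) (hpos : ∀ t, 0 ≤ t → 0 < x t)
    {c C T : ℝ} (hT : h₀ ≤ T) (hy : ∀ t ≥ T, Real.log (x t / K) ∈ Icc c C) :
    ∃ a b P, IsDelaySolution T h₀ (α / K * expQuotient C * r₀)
      (β * n * R / 4 / (α / K * expQuotient C * r₀)) (α / K * expQuotient c * R * h₀)
      a b h P (fun t => Real.log (x t / K)) := by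
  obtain ⟨hK0, -⟩ := id hK
  have hh₀ : 0 ≤ h₀ := by linarith [hh 0 le_rfl]
  have hT0 : 0 ≤ T := hh₀.trans hT
  have hαK : 0 < α / K := div_pos hα hK0
  set y : ℝ → ℝ := fun t => Real.log (x t / K) with hydef
  choose θ hθ0 hθn hθ using exists_hill_exp_sub_eq hn hK0
  have hyac : ∀ s t, T ≤ s → s ≤ t → AbsolutelyContinuousOnInterval y s t := by
    intro s t hs hst
    have h0 := hT0.trans hs
    refine absolutelyContinuousOnInterval_log (F := fun t => x t / K) ?_ fun u hu => ?_
    · simpa only [div_eq_inv_mul] using (hx.absCont_of_nonneg h0 hst).const_mul K⁻¹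
    · rw [uIcc_of_le hst] at hu
      exact div_pos (hpos u (h0.trans hu.1)) hK0
  have hycont : ContinuousOn y (Ici T) := by
    intro t ht
    have h1 : T ≤ t := ht
    have h2 := (hyac T (t + 1) le_rfl (by linarith)).continuousOn t
      (by rw [uIcc_of_le (by linarith)]; exact ⟨h1, by linarith⟩)
    rw [uIcc_of_le (by linarith)] at h2
    refine h2.mono_of_mem_nhdsWithin ?_
    rw [← Ici_inter_Iic]
    exact inter_mem_nhdsWithin _ (Iic_mem_nhds (by linarith))
  set a₁ : ℝ → ℝ := fun t => α / K * expQuotient (y t) * r t with ha₁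
  -- Bounds and continuity of `y` are available only on `[T, ∞)`; extension by zero makes `a`
  -- locally integrable on the line, so its integral is a primitive almost everywhere.
  set a : ℝ → ℝ := (Ici T).indicator a₁ with ha
  have haT : ∀ t, T ≤ t → a t = a₁ t := fun t ht => indicator_of_mem ht _
  have ha_low : ∀ t, T ≤ t → α / K * expQuotient C * r₀ ≤ a t := fun t ht => by
    rw [haT t ht]
    have h1 := expQuotient_antitone (hy t ht).2
    have h2 := (hr t (hT0.trans ht)).1
    have h3 := expQuotient_pos C
    have h4 := expQuotient_pos (y t)
    simp only [ha₁]
    gcongr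
  have hR : 0 < R := hr₀.trans_le ((hr 0 le_rfl).1.trans (hr 0 le_rfl).2)
  have ha_up : ∀ t, T ≤ t → a t ≤ α / K * expQuotient c * R := fun t ht => by
    rw [haT t ht]
    have h1 := expQuotient_antitone (hy t ht).1
    have h2 := (hr t (hT0.trans ht)).2
    have h3 := expQuotient_pos c
    simp only [ha₁]
    gcongr
    exact hr₀.le.trans (hr t (hT0.trans ht)).1
  have ha₀ : 0 < α / K * expQuotient C * r₀ :=
    mul_pos (mul_pos hαK (expQuotient_pos C)) hr₀
  have hA : 0 < α / K * expQuotient c * R := mul_pos (mul_pos hαK (expQuotient_pos c)) hR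
  have ha_meas : AEStronglyMeasurable a volume := by
    refine AEMeasurable.aestronglyMeasurable ?_
    rw [ha, aemeasurable_indicator_iff measurableSet_Ici]
    refine ((measurable_expQuotient.comp_aemeasurable
      (hycont.aemeasurable measurableSet_Ici)).const_mul _).mul ?_
    exact hr_meas.mono_measure (Measure.restrict_mono (Ici_subset_Ici.2 hT0) le_rfl)
  have ha_int : LocallyIntegrable a volume := by
    refine (locallyIntegrable_const (α / K * expQuotient c * R)).mono ha_meas
      (Eventually.of_forall fun t => ?_)
    rw [Real.norm_of_nonneg hA.le]
    rcases le_or_gt T t with h1 | h1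
    · rw [Real.norm_of_nonneg (ha₀.le.trans (ha_low t h1))]
      exact ha_up t h1
    · rw [ha, indicator_of_notMem (show t ∉ Ici T from not_le.2 h1), norm_zero]
      exact hA.le
  have hab_int : ∀ s t, IntervalIntegrable a volume s t := fun s t =>
    (ha_int.integrableOn_isCompact isCompact_uIcc).intervalIntegrable
  refine ⟨a, fun t => β * r t * θ (y (h t)), fun t => ∫ u in T..t, a u, ?_⟩
  refine ⟨hyac, fun s t hs hst => ?_, ?_, ?_, ha_low, fun t ht => ?_, fun t ht => ?_,
    fun t ht => ?_⟩
  · refine ((hab_int T t).absolutelyContinuousOnInterval_intervalIntegral left_mem_uIcc).mono ?_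
    rw [uIcc_of_le hst, uIcc_of_le (hs.trans hst)]
    exact Icc_subset_Icc_left hs
  · filter_upwards [LocallyIntegrable.ae_hasDerivAt_integral ha_int] with t ht _ using ht T
  · filter_upwards [hx.ae_hasDerivAt] with t ht hTt
    have h0 := hT0.trans hTt
    have hxt := hpos t h0
    have hxh := hpos (h t) (by linarith [hh t h0])
    have hd := ((ht h0).div_const K).log (div_pos hxt hK0).ne'
    refine hd.congr_deriv ?_
    rw [haT t hTt]
    have e1 := expQuotient_mul (y t)
    have e2 : Real.exp (-y t) = K / x t := by
      rw [Real.exp_neg, hydef, Real.exp_log (div_pos hxt hK0), inv_div]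
    have e3 : K * Real.exp (y (h t)) = x (h t) := by
      rw [hydef, Real.exp_log (div_pos hxh hK0)]; field_simp
    have e4 := hθ (y (h t))
    rw [e3] at e4
    have e5 := hK.mul_hill
    -- The equilibrium identity `α / K = β * hill n K` splits the right side into an instantaneous
    -- and a delayed part, each vanishing at the equilibrium.
    calc r t * (α - β * x t * hill n (x (h t))) / K / (x t / K)
        = -(r t * (α / K) * (1 - K / x t)) - β * r t * (hill n (x (h t)) - hill n K) := by
          have : α / K = β * hill n K := by rw [div_eq_iff hK0.ne']; linarith
          rw [this, ← e5]
          field_simp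
          ring
      _ = _ := by rw [← e2, ← e1, e4]; simp only [ha₁]; ring
  · have h0 := hT0.trans ht
    have hr0 := hr₀.le.trans (hr t h0).1
    refine ⟨mul_nonneg (mul_nonneg hβ.le hr0) (hθ0 _), ?_⟩
    calc β * r t * θ (y (h t)) ≤ β * R * (n / 4) := by
          have h1 := (hr t h0).2
          have h2 := hθn (y (h t))
          have h3 := hθ0 (y (h t))
          gcongr
      _ = β * n * R / 4 / (α / K * expQuotient C * r₀) * (α / K * expQuotient C * r₀) := by
          rw [div_mul_cancel₀ _ ha₀.ne']; ring
      _ ≤ _ := by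
          have := ha_low t ht
          gcongr
  · have := hh t (hT0.trans ht)
    exact ⟨by linarith, this.1⟩
  · have h1 := hh t (by linarith)
    have h2 : T ≤ h t := by linarith
    rw [intervalIntegral.integral_interval_sub_left (hab_int _ _) (hab_int _ _)]
    calc ∫ u in h t..t, a u ≤ ∫ _ in h t..t, α / K * expQuotient c * R :=
          intervalIntegral.integral_mono_on h1.1 (hab_int _ _) (by simp)
            fun u hu => ha_up u (h2.trans hu.1)
      _ = α / K * expQuotient c * R * (t - h t) := by
          rw [intervalIntegral.integral_const, smul_eq_mul, mul_comm]
      _ ≤ _ := by gcongr; exact h1.2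

end MackeyGlass

/-! ### Global attractivity -/

theorem theorem7 (α β n K r₀ R h₀ : ℝ) (r h : ℝ → ℝ)
    (hα : 0 < α) (hβ : 0 < β) (hn : 0 < n)
    (hK : MackeyGlass.IsPositiveEquilibrium α β n K)
    (hr_meas : AEMeasurable r (volume.restrict (Ici (0 : ℝ))))
    (hr₀ : 0 < r₀) (hr : ∀ t : ℝ, 0 ≤ t → r₀ ≤ r t ∧ r t ≤ R)
    (hh_meas : AEMeasurable h (volume.restrict (Ici (0 : ℝ))))
    (hh : ∀ t : ℝ, 0 ≤ t → h t ≤ t ∧ t - h t ≤ h₀)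
    (hineq : MackeyGlass.StabilityInequality
      (MackeyGlass.coeffLower α β n K r₀) (MackeyGlass.coeffUpper α β K R)
      (MackeyGlass.delayCoeff β n R) h₀)
    (φ x : ℝ → ℝ)
    (hφ_meas : Measurable (fun t : Iic (0 : ℝ) => φ t))
    (hφ_bdd : ∃ B : ℝ, ∀ t : ℝ, t ≤ 0 → |φ t| ≤ B)
    (hφ_nonneg : ∀ t : ℝ, t ≤ 0 → 0 ≤ φ t) (hφ_pos : 0 < φ 0)
    (hx : MackeyGlass.IsSolution α β n r h φ x) :
    Tendsto x atTop (𝓝 K) := by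
  obtain ⟨hK0, -⟩ := id hK
  have hh₀ : 0 ≤ h₀ := by linarith [hh 0 le_rfl]
  have hR : 0 < R := hr₀.trans_le ((hr 0 le_rfl).1.trans (hr 0 le_rfl).2)
  have hpos : ∀ t, 0 ≤ t → 0 < x t := fun t ht => hx.pos hα hβ
    (fun t ht => hr₀.le.trans (hr t ht).1) (fun t ht => (hh t ht).1) hφ_nonneg hφ_pos ht
  obtain ⟨T, hT, hbounds⟩ := hx.exists_forall_mem_Icc hα hβ hn hr₀ (fun t ht => (hr t ht).1) hh hpos
  have hμ : 0 < MackeyGlass.lowerBound α β := div_pos hα hβ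
  -- Starting at `T + h₀` keeps `h t ≥ 0`, so that `x (h t)` is positive and its logarithm
  -- meaningful.
  have hy : ∀ t ≥ T + h₀, Real.log (x t / K) ∈
      Icc (MackeyGlass.logLower α β K) (MackeyGlass.logUpper α β n K) := fun t ht => by
    obtain ⟨h1, h2⟩ := hbounds t (by linarith)
    have h3 := hpos t (by linarith)
    exact ⟨Real.log_le_log (by positivity) (by gcongr), Real.log_le_log (by positivity) (by gcongr)⟩
  obtain ⟨a, b, P, S⟩ := hx.exists_isDelaySolution hα hβ hn hK hr_meas hr₀ hr hh hpos
    (show h₀ ≤ T + h₀ by linarith) hy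
  have hc : MackeyGlass.logLower α β K ≠ 0 :=
    (Real.log_neg (by positivity) ((div_lt_one hK0).2 (hK.lowerBound_lt hβ))).ne
  have hC : MackeyGlass.logUpper α β n K ≠ 0 :=
    (Real.log_pos ((one_lt_div hK0).2 (hK.lt_upperBound hα hβ hn))).ne'
  have ha₀ : MackeyGlass.coeffLower α β n K r₀ =
      α / K * MackeyGlass.expQuotient (MackeyGlass.logUpper α β n K) * r₀ := by
    rw [MackeyGlass.coeffLower, MackeyGlass.expQuotient, if_neg hC]
  have hA : MackeyGlass.coeffUpper α β K R =
      α / K * MackeyGlass.expQuotient (MackeyGlass.logLower α β K) * R := by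
    rw [MackeyGlass.coeffUpper, MackeyGlass.expQuotient, if_neg hc]
  rw [← ha₀, ← hA] at S
  have ha₀_pos : 0 < MackeyGlass.coeffLower α β n K r₀ := by
    rw [ha₀]; exact mul_pos (mul_pos (div_pos hα hK0) (MackeyGlass.expQuotient_pos _)) hr₀
  have hb₀_pos : 0 < MackeyGlass.delayCoeff β n R := by
    rw [MackeyGlass.delayCoeff]; positivity
  rw [← MackeyGlass.delayCoeff] at S
  unfold MackeyGlass.StabilityInequality at hineq
  set a₀ := MackeyGlass.coeffLower α β n K r₀
  set b₀ := MackeyGlass.delayCoeff β n R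
  set A := MackeyGlass.coeffUpper α β K R
  have hlim := S.tendsto_zero ha₀_pos (div_pos hb₀_pos ha₀_pos)
    (fun t ht => abs_le_max_abs_abs (hy t ht).1 (hy t ht).2) (by
      -- With `q = b₀ / a₀` and `H = A h₀`, the contraction condition is the stability inequality
      -- multiplied by `(b₀ / a₀) e^(A h₀)`.
      rw [show ((b₀ / a₀) ^ 2 + b₀ / a₀) / ((b₀ / a₀) ^ 2 + 1)
        = (b₀ ^ 2 + a₀ * b₀) / (b₀ ^ 2 + a₀ ^ 2) by field_simp]
      calc b₀ / a₀ * Real.exp (A * h₀) * Real.log ((b₀ ^ 2 + a₀ * b₀) / (b₀ ^ 2 + a₀ ^ 2))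
          < b₀ / a₀ * Real.exp (A * h₀) * (a₀ / b₀ * Real.exp (-(A * h₀))) := by gcongr
        _ = 1 := by rw [Real.exp_neg]; field_simp)
  have hlim' := (hlim.rexp).const_mul K
  rw [Real.exp_zero, mul_one] at hlim'
  refine hlim'.congr' ?_
  filter_upwards [eventually_ge_atTop 0] with t ht
  rw [Real.exp_log (div_pos (hpos t ht) hK0)]
  field_simp
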